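/- A group $G$ is called acyclically closed if, for every $m\ge 0$ and all words $w_1,\dots,w_m\in G*F_m$ ($F_m$ free on $x_1,\dots,x_m$) lying in the kernel of $G*F_m\to F_m\to H_1(F_m)$, the system $x_i=w_i(x_1,\dots,x_m)$ $(1\le i\le m)$ has exactly one solution in $G$. The acyclic closure of a group $G$ is the (up to isomorphism unique) homomorphism $\iota\colon G\to G^{\mathrm{acy}}$ to an acyclically closed group along which every homomorphism from $G$ to an acyclically closed group extends uniquely. Let $n\ge 2$, let $F_n$ be the free group with basis $\gamma_1,\dots,\gamma_n$, write $\gamma_i$ also for its images in $F_n^{\mathrm{acy}}$ and in $H_1:=H_1(F_n)$ (written multiplicatively), and let $\mathcal K$ be the field of fractions of $\mathbb Z[H_1]$. The ring $\mathbb Z[F_n^{\mathrm{acy}}]$ acts on $\mathcal K$ through the unique homomorphism $F_n^{\mathrm{acy}}\to H_1$ extending $F_n\to H_1$. Let $I$ be the augmentation ideal of $\mathbb Z[F_n^{\mathrm{acy}}]$ and let $$\chi\colon\mathcal K^n\to I\otimes_{\mathbb Z[F_n^{\mathrm{acy}}]}\mathcal K,\qquad (a_1,\dots,a_n)\mapsto\sum_{i=1}^n(\gamma_i^{-1}-1)\otimes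 a_i .$$ Then: 1. $F_n^{\mathrm{acy}}$ is not finitely generated. 2. The map $\chi$ is bijective, so that the extended Fox derivatives $\partial v/\partial\gamma_i:=\overline{\chi^{-1}((v^{-1}-1)\otimes 1)_i}\in\mathcal K$ of $v\in F_n^{\mathrm{acy}}$ are defined; here the bar is the involution of $\mathcal K$ induced by $h\mapsto h^{-1}$ on $H_1$. For every $m$ such that $2m+1$ is prime, the element $p_m:=1-\gamma_2+\gamma_2^2-\dots+\gamma_2^{2m}$ is irreducible in $\mathbb Z[H_1]$, and there is $v\in F_n^{\mathrm{acy}}$ with $\partial v/\partial\gamma_1=1/p_m$. In particular, infinitely many distinct irreducible elements of the form $p_m$ occur as denominators in this way. 3. The metabelian quotient $F_n^{\mathrm{acy}}/[[F_n^{\mathrm{acy}},F_n^{\mathrm{acy}}],[F_n^{\mathrm{acy}},F_n^{\mathrm{acy}}]]$ is not finitely generated. -/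

import Mathlib

/-! ### Acyclically closed groups -/

universe u

/-- A word `w ∈ G ∗ F_m` is acyclic if it lies in the kernel of `G ∗ F_m → F_m → H₁(F_m)`. -/
def IsAcyclicWord {G : Type u} [Group G] {m : ℕ}
    (w : Monoid.Coprod G (FreeGroup (Fin m))) : Prop :=
  w ∈ ((Abelianization.of (G := FreeGroup (Fin m))).comp Monoid.Coprod.snd).ker

/-- The group `(G ∗ F_m) / ⟨⟨x₁ w₁⁻¹, …, x_m w_m⁻¹⟩⟩` of a system of equations `x_i = w_i`. -/
abbrev SystemGroup {G : Type u} [Group G] {m : ℕ}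
    (w : Fin m → Monoid.Coprod G (FreeGroup (Fin m))) : Type u :=
  Monoid.Coprod G (FreeGroup (Fin m)) ⧸
    Subgroup.normalClosure (Set.range fun i => Monoid.Coprod.inr (FreeGroup.of i) * (w i)⁻¹)

/-- A solution in `G` of the system `x_i = w_i`: a homomorphism from the group of the system to
`G` which restricts to the identity on `G`. -/
def IsSystemSolution {G : Type u} [Group G] {m : ℕ}
    (w : Fin m → Monoid.Coprod G (FreeGroup (Fin m))) (φ : SystemGroup w →* G) : Prop :=
  (φ.comp (QuotientGroup.mk' _)).comp Monoid.Coprod.inl = MonoidHom.id G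

/-- A group is acyclically closed if every acyclic system over it has a unique solution in it. -/
def IsAC (G : Type u) [Group G] : Prop :=
  ∀ (m : ℕ) (w : Fin m → Monoid.Coprod G (FreeGroup (Fin m))),
    (∀ i, IsAcyclicWord (w i)) → ∃! φ : SystemGroup w →* G, IsSystemSolution w φ

/-- `ι : G → P` is an acyclic closure of `G`: `P` is acyclically closed, and every homomorphism
from `G` to an acyclically closed group extends uniquely along `ι`. -/
structure IsAcyclicClosure {G P : Type u} [Group G] [Group P] (ι : G →* P) : Prop where
  isAC : IsAC P
  existsUnique_extension : ∀ (A : Type u) [Group A], IsAC A → ∀ f : G →* A,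
    ∃! g : P →* A, g.comp ι = f

/-- Solutions of a system, written as tuples `x` with `x_i = w_i(x)`. -/
theorem isAC_iff_tuple {G : Type u} [Group G] : IsAC G ↔
    ∀ (m : ℕ) (w : Fin m → Monoid.Coprod G (FreeGroup (Fin m))), (∀ i, IsAcyclicWord (w i)) →
      ∃! x : Fin m → G,
        ∀ i, x i = Monoid.Coprod.lift (MonoidHom.id G) (FreeGroup.lift x) (w i) := by
  refine forall_congr' fun m => forall_congr' fun w => imp_congr_right fun _ => ?_
  have key : ∀ (φ : SystemGroup w →* G), IsSystemSolution w φ →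
      φ.comp (QuotientGroup.mk' _) = Monoid.Coprod.lift (MonoidHom.id G)
        (FreeGroup.lift fun i => φ (QuotientGroup.mk (Monoid.Coprod.inr (FreeGroup.of i)))) := by
    intro φ hφ
    refine Monoid.Coprod.hom_ext ?_ ?_
    · rw [Monoid.Coprod.lift_comp_inl]; exact hφ
    · rw [Monoid.Coprod.lift_comp_inr]; ext i; simp
  have key2 : ∀ (φ : SystemGroup w →* G) (i : Fin m),
      φ (QuotientGroup.mk (Monoid.Coprod.inr (FreeGroup.of i))) = φ (QuotientGroup.mk (w i)) := by
    intro φ i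
    congr 1
    rw [← mul_inv_eq_one, ← QuotientGroup.mk_inv, ← QuotientGroup.mk_mul, QuotientGroup.eq_one_iff]
    exact Subgroup.subset_normalClosure ⟨i, rfl⟩
  have mkφ : ∀ x : Fin m → G,
      (∀ i, x i = Monoid.Coprod.lift (MonoidHom.id G) (FreeGroup.lift x) (w i)) →
      ∃ φ : SystemGroup w →* G, IsSystemSolution w φ ∧
        ∀ i, φ (QuotientGroup.mk (Monoid.Coprod.inr (FreeGroup.of i))) = x i := by
    intro x hx
    have hle : Subgroup.normalClosure
        (Set.range fun i => Monoid.Coprod.inr (FreeGroup.of i) * (w i)⁻¹) ≤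
        (Monoid.Coprod.lift (MonoidHom.id G) (FreeGroup.lift x)).ker := by
      refine Subgroup.normalClosure_le_normal ?_
      rintro _ ⟨i, rfl⟩
      simp only [SetLike.mem_coe, MonoidHom.mem_ker, map_mul, map_inv,
        Monoid.Coprod.lift_apply_inr, FreeGroup.lift_apply_of]
      rw [← hx i, mul_inv_cancel]
    refine ⟨QuotientGroup.lift _ _ hle, ?_, fun i => ?_⟩
    · ext g; simp
    · simp
  constructor
  · rintro ⟨φ, hφ, huniq⟩
    refine ⟨fun i => φ (QuotientGroup.mk (Monoid.Coprod.inr (FreeGroup.of i))), fun i => ?_, ?_⟩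
    · rw [← key φ hφ]; exact key2 φ i
    · intro x hx
      obtain ⟨ψ, hψ, hψx⟩ := mkφ x hx
      funext i
      rw [← hψx i, huniq ψ hψ]
  · rintro ⟨x, hx, huniq⟩
    obtain ⟨φ, hφ, hφx⟩ := mkφ x hx
    refine ⟨φ, hφ, fun ψ hψ => ?_⟩
    have h1 := huniq (fun i => ψ (QuotientGroup.mk (Monoid.Coprod.inr (FreeGroup.of i))))
      (fun i => by rw [← key ψ hψ]; exact key2 ψ i)
    refine QuotientGroup.monoidHom_ext _ ?_
    rw [key ψ hψ, key φ hφ, h1]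
    congr 2
    funext i
    exact (hφx i).symm

/-- Abelian groups are acyclically closed. -/
theorem isAC_of_commGroup (A : Type u) [CommGroup A] : IsAC A := by
  refine isAC_iff_tuple.mpr fun m w hw => ?_
  have h : ∀ (x : Fin m → A) (v : Monoid.Coprod A (FreeGroup (Fin m))),
      Monoid.Coprod.lift (MonoidHom.id A) (FreeGroup.lift x) v =
        Monoid.Coprod.fst v * Abelianization.lift (FreeGroup.lift x)
          (Abelianization.of (Monoid.Coprod.snd v)) := by
    intro x v
    have : Monoid.Coprod.lift (MonoidHom.id A) (FreeGroup.lift x) =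
        Monoid.Coprod.fst * ((Abelianization.lift (FreeGroup.lift x)).comp
          (Abelianization.of.comp Monoid.Coprod.snd)) :=
      Monoid.Coprod.hom_ext (by ext; simp) (by ext; simp)
    rw [this]; rfl
  have h' : ∀ (x : Fin m → A) (i : Fin m),
      Monoid.Coprod.lift (MonoidHom.id A) (FreeGroup.lift x) (w i) = Monoid.Coprod.fst (w i) := by
    intro x i
    have := hw i
    rw [IsAcyclicWord, MonoidHom.mem_ker, MonoidHom.comp_apply] at this
    rw [h, this, map_one, mul_one]
  refine ⟨fun i => Monoid.Coprod.fst (w i), fun i => (h' _ i).symm, fun x hx => ?_⟩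
  funext i
  rw [hx i, h']

/-! ### Construction of the acyclic closure

Formal terms are built from the elements of `G` by multiplication, inversion and the formation of
solutions of acyclic systems. The coefficients of a system are terms `c 0, c 1, …`, and its right
hand sides are words in the coefficients (letters `Sum.inl k`) and the variables (letters
`Sum.inr i`). The acyclic closure is the set of terms up to equality of their values in all
acyclically closed groups. -/

/-- The part of a word which consists of the variables. -/
def variablePart (m : ℕ) : FreeGroup (ℕ ⊕ Fin m) →* FreeGroup (Fin m) :=
  FreeGroup.lift (Sum.elim (fun _ => 1) FreeGroup.of)

/-- Formal terms over `G`; `sol w hw c i` stands for the `i`-th component of the solution of the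
acyclic system `x_j = w_j(c, x)`. -/
inductive AcyTerm (G : Type u) : Type u
  | of (g : G) : AcyTerm G
  | mul (s t : AcyTerm G) : AcyTerm G
  | inv (s : AcyTerm G) : AcyTerm G
  | sol {m : ℕ} (w : Fin m → FreeGroup (ℕ ⊕ Fin m))
      (hw : ∀ i, Abelianization.of (variablePart m (w i)) = 1)
      (c : ℕ → AcyTerm G) (i : Fin m) : AcyTerm G

theorem IsAC.existsUnique_word {A : Type u} [Group A] (hA : IsAC A) {m : ℕ}
    (w : Fin m → FreeGroup (ℕ ⊕ Fin m))
    (hw : ∀ i, Abelianization.of (variablePart m (w i)) = 1) (c : ℕ → A) :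
    ∃! x : Fin m → A, ∀ i, x i = FreeGroup.lift (Sum.elim c x) (w i) := by
  let T : FreeGroup (ℕ ⊕ Fin m) →* Monoid.Coprod A (FreeGroup (Fin m)) :=
    FreeGroup.lift (Sum.elim (fun k => Monoid.Coprod.inl (c k))
      fun i => Monoid.Coprod.inr (FreeGroup.of i))
  have h1 : Monoid.Coprod.snd.comp T = variablePart m := by
    ext (k | i) <;> simp [T, variablePart]
  have h2 : ∀ x : Fin m → A, (Monoid.Coprod.lift (MonoidHom.id A) (FreeGroup.lift x)).comp T =
      FreeGroup.lift (Sum.elim c x) := by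
    intro x
    ext (k | i) <;> simp [T]
  have := isAC_iff_tuple.mp hA m (fun i => T (w i)) (fun i => by
    rw [IsAcyclicWord, MonoidHom.mem_ker, MonoidHom.comp_apply, ← MonoidHom.comp_apply _ T, h1]
    exact hw i)
  simpa only [← MonoidHom.comp_apply, h2] using this

/-- The solution of an acyclic system with coefficients `c`. -/
noncomputable def IsAC.solution {A : Type u} [Group A] (hA : IsAC A) {m : ℕ}
    (w : Fin m → FreeGroup (ℕ ⊕ Fin m))
    (hw : ∀ i, Abelianization.of (variablePart m (w i)) = 1) (c : ℕ → A) : Fin m → A :=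
  (hA.existsUnique_word w hw c).choose

theorem IsAC.solution_spec {A : Type u} [Group A] (hA : IsAC A) {m : ℕ}
    (w : Fin m → FreeGroup (ℕ ⊕ Fin m))
    (hw : ∀ i, Abelianization.of (variablePart m (w i)) = 1) (c : ℕ → A) (i : Fin m) :
    hA.solution w hw c i = FreeGroup.lift (Sum.elim c (hA.solution w hw c)) (w i) :=
  (hA.existsUnique_word w hw c).choose_spec.1 i

theorem IsAC.eq_solution {A : Type u} [Group A] (hA : IsAC A) {m : ℕ}
    (w : Fin m → FreeGroup (ℕ ⊕ Fin m))
    (hw : ∀ i, Abelianization.of (variablePart m (w i)) = 1) (c : ℕ → A) (x : Fin m → A)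
    (hx : ∀ i, x i = FreeGroup.lift (Sum.elim c x) (w i)) : x = hA.solution w hw c :=
  (hA.existsUnique_word w hw c).choose_spec.2 x hx

/-- The value of a term in an acyclically closed group `A`, along `f : G → A`. -/
noncomputable def AcyTerm.eval {G A : Type u} [Group G] [Group A] (hA : IsAC A) (f : G →* A) :
    AcyTerm G → A
  | .of g => f g
  | .mul s t => s.eval hA f * t.eval hA f
  | .inv s => (s.eval hA f)⁻¹
  | .sol w hw c i => hA.solution w hw (fun k => (c k).eval hA f) i

/-- Two terms are identified if they have the same value in every acyclically closed group. -/
def acyTermSetoid (G : Type u) [Group G] : Setoid (AcyTerm G) where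
  r s t := ∀ (A : Type u) [Group A] (hA : IsAC A) (f : G →* A), s.eval hA f = t.eval hA f
  iseqv := ⟨fun _ _ _ _ _ => rfl, fun h A _ hA f => (h A hA f).symm,
    fun h h' A _ hA f => (h A hA f).trans (h' A hA f)⟩

/-- The acyclic closure of `G`. -/
def AcyclicClosure (G : Type u) [Group G] : Type u := Quotient (acyTermSetoid G)

namespace AcyclicClosure

/-- The element of the acyclic closure which a term stands for. -/
def mk {G : Type u} [Group G] (t : AcyTerm G) : AcyclicClosure G := Quotient.mk _ t

theorem exists_mk {G : Type u} [Group G] (a : AcyclicClosure G) : ∃ t, mk t = a :=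
  Quotient.exists_rep a

instance {G : Type u} [Group G] : Group (AcyclicClosure G) where
  mul := Quotient.map₂ AcyTerm.mul fun _ _ h _ _ h' A _ hA f =>
    congrArg₂ (· * ·) (h A hA f) (h' A hA f)
  one := Quotient.mk _ (AcyTerm.of 1)
  inv := Quotient.map AcyTerm.inv fun _ _ h A _ hA f => congrArg (·⁻¹) (h A hA f)
  mul_assoc a b c := by
    induction a using Quotient.ind
    induction b using Quotient.ind
    induction c using Quotient.ind
    exact Quotient.sound fun A _ hA f => mul_assoc _ _ _
  one_mul a := by
    induction a using Quotient.ind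
    exact Quotient.sound fun A _ hA f => by simp [AcyTerm.eval]
  mul_one a := by
    induction a using Quotient.ind
    exact Quotient.sound fun A _ hA f => by simp [AcyTerm.eval]
  inv_mul_cancel a := by
    induction a using Quotient.ind
    exact Quotient.sound fun A _ hA f => by simp [AcyTerm.eval]

/-- The canonical homomorphism from `G` to its acyclic closure. -/
def ι (G : Type u) [Group G] : G →* AcyclicClosure G where
  toFun g := mk (AcyTerm.of g)
  map_one' := rfl
  map_mul' a b := Quotient.sound fun A _ hA f => by simp [AcyTerm.eval]

theorem mk_mul {G : Type u} [Group G] (s t : AcyTerm G) : mk (s.mul t) = mk s * mk t := rfl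

theorem mk_inv {G : Type u} [Group G] (s : AcyTerm G) : mk s.inv = (mk s)⁻¹ := rfl

/-- The extension to the acyclic closure of a homomorphism to an acyclically closed group. -/
noncomputable def lift {G A : Type u} [Group G] [Group A] (hA : IsAC A) (f : G →* A) :
    AcyclicClosure G →* A where
  toFun := Quotient.lift (fun t => t.eval hA f) fun _ _ h => h A hA f
  map_one' := f.map_one
  map_mul' a b := by
    induction a using Quotient.ind
    induction b using Quotient.ind
    rfl

theorem lift_mk {G A : Type u} [Group G] [Group A] (hA : IsAC A) (f : G →* A) (t : AcyTerm G) :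
    lift hA f (mk t) = t.eval hA f := rfl

theorem lift_comp_ι {G A : Type u} [Group G] [Group A] (hA : IsAC A) (f : G →* A) :
    (lift hA f).comp (ι G) = f := rfl

/-- The evaluations in acyclically closed groups separate the elements of the acyclic closure. -/
theorem ext_lift {G : Type u} [Group G] {a b : AcyclicClosure G}
    (h : ∀ (A : Type u) [Group A] (hA : IsAC A) (f : G →* A), lift hA f a = lift hA f b) :
    a = b := by
  induction a using Quotient.ind
  induction b using Quotient.ind
  exact Quotient.sound fun A _ hA f => h A hA f

end AcyclicClosure

/-- Two relabellings of a word agree if they agree on its letters. -/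
theorem FreeGroup.map_eq_of_eqOn_letters {α β : Type*} [DecidableEq α] (f g : α → β)
    (w : FreeGroup α) (h : ∀ a b, (a, b) ∈ w.toWord → f a = g a) :
    FreeGroup.map f w = FreeGroup.map g w := by
  conv_lhs => rw [← FreeGroup.mk_toWord (x := w)]
  conv_rhs => rw [← FreeGroup.mk_toWord (x := w)]
  rw [FreeGroup.map.mk, FreeGroup.map.mk]
  congr 1
  refine List.map_congr_left ?_
  rintro ⟨a, b⟩ hab
  simp [h a b hab]

/-- Finitely many words over `A` in variables `x_i` are given by words in countably many
coefficients. -/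
theorem exists_words {A : Type u} [Group A] {m : ℕ}
    (v : Fin m → Monoid.Coprod A (FreeGroup (Fin m))) :
    ∃ (c : ℕ → A) (w : Fin m → FreeGroup (ℕ ⊕ Fin m)), ∀ i,
      FreeGroup.lift (Sum.elim (fun k => Monoid.Coprod.inl (c k))
        fun j => Monoid.Coprod.inr (FreeGroup.of j)) (w i) = v i := by
  classical
  let S : FreeGroup (A ⊕ Fin m) →* Monoid.Coprod A (FreeGroup (Fin m)) :=
    FreeGroup.lift (Sum.elim (fun a => Monoid.Coprod.inl a)
      fun j => Monoid.Coprod.inr (FreeGroup.of j))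
  have hS : ∀ y, ∃ u, S u = y := by
    intro y
    induction y using Monoid.Coprod.induction_on with
    | inl a => exact ⟨FreeGroup.of (Sum.inl a), by simp [S]⟩
    | inr b =>
      refine ⟨FreeGroup.map Sum.inr b, ?_⟩
      have : S.comp (FreeGroup.map Sum.inr) = Monoid.Coprod.inr := by ext; simp [S]
      exact DFunLike.congr_fun this b
    | mul x y hx hy =>
      obtain ⟨a, rfl⟩ := hx
      obtain ⟨b, rfl⟩ := hy
      exact ⟨a * b, map_mul _ _ _⟩
  choose u hu using fun i => hS (v i)
  obtain ⟨L, hL⟩ : ∃ L : List A, ∀ i a b, (Sum.inl a, b) ∈ (u i).toWord → a ∈ L := by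
    refine ⟨(List.ofFn fun i => (u i).toWord.filterMap fun p => p.1.getLeft?).flatten, ?_⟩
    intro i a b hab
    rw [List.mem_flatten]
    exact ⟨_, List.mem_ofFn.mpr ⟨i, rfl⟩, List.mem_filterMap.mpr ⟨_, hab, rfl⟩⟩
  let c : ℕ → A := fun k => L.getD k 1
  refine ⟨c, fun i => FreeGroup.map (Sum.map (fun a => L.idxOf a) id) (u i), fun i => ?_⟩
  have h1 : (FreeGroup.lift (Sum.elim (fun k => Monoid.Coprod.inl (c k))
      fun j => Monoid.Coprod.inr (FreeGroup.of j)) :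
      FreeGroup (ℕ ⊕ Fin m) →* Monoid.Coprod A (FreeGroup (Fin m))) =
      S.comp (FreeGroup.map (Sum.map c id)) := by
    ext (k | j) <;> simp [S]
  rw [h1, MonoidHom.comp_apply, FreeGroup.map.comp, ← hu i]
  congr 1
  rw [FreeGroup.map_eq_of_eqOn_letters _ id (u i), FreeGroup.map.id]
  rintro (a | j) b hab
  · have ha := hL i a b hab
    simp [c, List.getD_eq_getElem?_getD, List.getElem?_eq_getElem (List.idxOf_lt_length_iff.mpr ha)]
  · rfl

namespace AcyclicClosure

theorem isAC (G : Type u) [Group G] : IsAC (AcyclicClosure G) := by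
  refine isAC_iff_tuple.mpr fun m v hv => ?_
  obtain ⟨c, w, hw⟩ := exists_words v
  have hs : (Monoid.Coprod.snd.comp (FreeGroup.lift (Sum.elim (fun k => Monoid.Coprod.inl (c k))
      fun j => Monoid.Coprod.inr (FreeGroup.of j)) :
      FreeGroup (ℕ ⊕ Fin m) →* Monoid.Coprod (AcyclicClosure G) (FreeGroup (Fin m)))) =
      variablePart m := by
    ext (k | j) <;> simp [variablePart]
  have hacy : ∀ i, Abelianization.of (variablePart m (w i)) = 1 := by
    intro i
    have := hv i
    rw [IsAcyclicWord, MonoidHom.mem_ker, MonoidHom.comp_apply, ← hw i] at this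
    rw [← hs]
    exact this
  have hl : ∀ x : Fin m → AcyclicClosure G, ∀ i,
      Monoid.Coprod.lift (MonoidHom.id _) (FreeGroup.lift x) (v i) =
        FreeGroup.lift (Sum.elim c x) (w i) := by
    intro x i
    rw [← hw i, ← MonoidHom.comp_apply]
    congr 1
    ext (k | j) <;> simp
  simp only [hl]
  have hpush : ∀ (A : Type u) [Group A] (F : AcyclicClosure G →* A) (x : Fin m → AcyclicClosure G)
      (i : Fin m), F (FreeGroup.lift (Sum.elim c x) (w i)) =
        FreeGroup.lift (Sum.elim (fun k => F (c k)) fun j => F (x j)) (w i) := by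
    intro A _ F x i
    rw [← MonoidHom.comp_apply]
    congr 1
    ext (k | j) <;> simp
  let ct : ℕ → AcyTerm G := fun k => Quotient.out (c k)
  have hct : ∀ k, mk (ct k) = c k := fun k => Quotient.out_eq (s := acyTermSetoid G) (c k)
  have hlc : ∀ (A : Type u) [Group A] (hA : IsAC A) (f : G →* A) (k : ℕ),
      lift hA f (c k) = (ct k).eval hA f := by
    intro A _ hA f k
    rw [← hct k]
    rfl
  refine ⟨fun i => mk (AcyTerm.sol w hacy ct i), fun i => ?_, fun x hx => ?_⟩
  · refine ext_lift fun A _ hA f => ?_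
    rw [hpush, lift_mk, AcyTerm.eval]
    simp only [hlc]
    exact hA.solution_spec w hacy _ i
  · funext i
    refine ext_lift fun A _ hA f => ?_
    have := hA.eq_solution w hacy (fun k => lift hA f (c k)) (fun j => lift hA f (x j))
      (fun j => by rw [← hpush, ← hx j])
    simp only [hlc] at this
    exact congrFun this i

theorem hom_ext {G A : Type u} [Group G] [Group A] (hA : IsAC A) {g g' : AcyclicClosure G →* A}
    (h : g.comp (ι G) = g'.comp (ι G)) : g = g' := by
  have key : ∀ g : AcyclicClosure G →* A, ∀ t : AcyTerm G,
      g (mk t) = t.eval hA (g.comp (ι G)) := by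
    intro g t
    induction t with
    | of a => rfl
    | mul s t hs ht =>
      rw [AcyTerm.eval, ← hs, ← ht, ← map_mul, mk_mul]
    | inv s hs =>
      rw [AcyTerm.eval, ← hs, ← map_inv, mk_inv]
    | @sol m w hw c i hc =>
      simp only [AcyTerm.eval, ← hc]
      refine congrFun (hA.eq_solution w hw _
        (fun j => g (mk (AcyTerm.sol w hw c j))) fun j => ?_) i
      have h1 : mk (AcyTerm.sol w hw c j) =
          FreeGroup.lift (Sum.elim (fun k => mk (c k))
            fun l => mk (AcyTerm.sol w hw c l)) (w j) := by
        refine ext_lift fun B _ hB f => ?_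
        rw [← MonoidHom.comp_apply]
        refine (hB.solution_spec w hw _ j).trans ?_
        congr 1
        ext (k | l) <;> simp [lift_mk, AcyTerm.eval]
      rw [h1, ← MonoidHom.comp_apply]
      congr 1
      ext (k | l) <;> simp
  ext a
  obtain ⟨t, rfl⟩ := exists_mk a
  rw [key, key, h]

/-- `ι : G → AcyclicClosure G` has the universal property that characterizes the acyclic closure. -/
theorem isAcyclicClosure (G : Type u) [Group G] : IsAcyclicClosure (ι G) where
  isAC := isAC G
  existsUnique_extension _ _ hA f :=
    ⟨lift hA f, lift_comp_ι hA f, fun _ hg => hom_ext hA (hg.trans (lift_comp_ι hA f).symm)⟩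

end AcyclicClosure

/-! ### Extended Fox derivatives -/

/-- The first homology group `H₁(F_n)`, written multiplicatively. -/
abbrev FreeH1 (n : ℕ) : Type := Abelianization (FreeGroup (Fin n))

instance (n : ℕ) : UniqueProds (FreeH1 n) :=
  inferInstanceAs (UniqueProds (Multiplicative (FreeAbelianGroup (Fin n))))

/-- The field `K_{H₁}`: the field of fractions of the group ring `ℤ[H₁]`. -/
abbrev KField (n : ℕ) : Type := FractionRing (MonoidAlgebra ℤ (FreeH1 n))

/-- The acyclic closure of the free group of rank `n`. -/
abbrev FAcy (n : ℕ) : Type := AcyclicClosure (FreeGroup (Fin n))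

/-- The image in `F_n^acy` of the `i`-th basis element of `F_n`. -/
def gam {n : ℕ} (i : Fin n) : FAcy n := AcyclicClosure.ι _ (FreeGroup.of i)

/-- The projection `F_n^acy → H₁`, the unique extension of `F_n → H₁`. -/
noncomputable def toH1 (n : ℕ) : FAcy n →* FreeH1 n :=
  AcyclicClosure.lift (isAC_of_commGroup _) Abelianization.of

/-- The ring homomorphism `ℤ[F_n^acy] → K_{H₁}` through which `ℤ[F_n^acy]` acts on `K_{H₁}`. -/
noncomputable def toK (n : ℕ) : MonoidAlgebra ℤ (FAcy n) →+* KField n :=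
  (algebraMap (MonoidAlgebra ℤ (FreeH1 n)) (KField n)).comp
    (MonoidAlgebra.mapDomainRingHom ℤ (toH1 n))

/-- The trivializer `ℤ[F_n^acy] → ℤ`, sending each group element to `1`. -/
noncomputable def trivializer (n : ℕ) : MonoidAlgebra ℤ (FAcy n) →+* ℤ :=
  (MonoidAlgebra.lift ℤ ℤ (FAcy n) 1).toRingHom

/-- The augmentation ideal `I(F_n^acy)` (a two-sided ideal). -/
noncomputable def augIdeal (n : ℕ) : Ideal (MonoidAlgebra ℤ (FAcy n)) :=
  RingHom.ker (trivializer n)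

/-- `I(F_n^acy)` as a right module over `ℤ[F_n^acy]`. -/
noncomputable def augMul {n : ℕ} (x : augIdeal n) (r : MonoidAlgebra ℤ (FAcy n)) : augIdeal n :=
  ⟨x * r, by
    have hx : trivializer n x = 0 := x.2
    simp [augIdeal, RingHom.mem_ker, hx]⟩

open scoped TensorProduct in
/-- The tensor product `I(F_n^acy) ⊗ K_{H₁}` over the noncommutative ring `ℤ[F_n^acy]`: the
quotient of the tensor product over `ℤ` by the relations `x r ⊗ a = x ⊗ r a`. The factor `K_{H₁}`
is written on the left, which makes the tensor product a `K_{H₁}`-vector space in Lean. -/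
abbrev AugTensor (n : ℕ) : Type :=
  (KField n ⊗[ℤ] augIdeal n) ⧸ Submodule.span (KField n)
    {z | ∃ (x : augIdeal n) (r : MonoidAlgebra ℤ (FAcy n)) (a : KField n),
      z = a ⊗ₜ[ℤ] augMul x r - (toK n r * a) ⊗ₜ[ℤ] x}

open scoped TensorProduct in
/-- The pure tensor `x ⊗ a`. -/
noncomputable def augTmul {n : ℕ} (x : augIdeal n) (a : KField n) : AugTensor n :=
  Submodule.Quotient.mk (a ⊗ₜ[ℤ] x)

/-- The element `v⁻¹ - 1` of the augmentation ideal. -/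
noncomputable def invSubOne {n : ℕ} (v : FAcy n) : augIdeal n :=
  ⟨MonoidAlgebra.of ℤ _ v⁻¹ - 1, by simp [augIdeal, trivializer, RingHom.mem_ker]⟩

/-- The map `χ : K_{H₁}^n → I(F_n^acy) ⊗ K_{H₁}`, `(a_i) ↦ ∑ (γ_i⁻¹ - 1) ⊗ a_i`. -/
noncomputable def chi (n : ℕ) (a : Fin n → KField n) : AugTensor n :=
  ∑ i, augTmul (invSubOne (gam i)) (a i)

/-- The involution of `K_{H₁}` induced by `h ↦ h⁻¹` on `H₁`. -/
noncomputable def bar (n : ℕ) : KField n ≃+* KField n :=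
  IsFractionRing.ringEquivOfRingEquiv
    (MonoidAlgebra.mapDomainRingEquiv ℤ (MulEquiv.inv (FreeH1 n)))

/-- The extended Fox derivative `∂v/∂γ_i`: the `i`-th component of `χ⁻¹((v⁻¹ - 1) ⊗ 1)`, with the
involution applied. (The inverse is the genuine one whenever `χ` is bijective.) -/
noncomputable def foxDeriv {n : ℕ} (i : Fin n) (v : FAcy n) : KField n :=
  bar n (Function.invFun (chi n) (augTmul (invSubOne v) 1) i)

/-- The element `1 - h + h² - … + h^{2m}` of `ℤ[H₁]`. -/
noncomputable def altSum {n : ℕ} (h : FreeH1 n) (m : ℕ) : MonoidAlgebra ℤ (FreeH1 n) :=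
  ∑ k ∈ Finset.range (2 * m + 1), (-MonoidAlgebra.of ℤ _ h) ^ k

/-!
Let `K` be the field of fractions of `ℤ[H₁]`. The semidirect product `K ⋊ H₁` is acyclically closed
(`AffineGroup.isAC`): in the abelian group `H₁` an acyclic system has one solution, and the
`K`-components then have to solve a linear system with matrix `1 - A`, where the entries of `A` are
Fox derivatives of acyclic words and so have augmentation `0`. Hence `det (1 - A)` has augmentation
`1` and is invertible in `K`. By the universal property every assignment of values in `K` to the
`γ_i` extends uniquely to a derivation `F_n^acy → K`.

The existence of these derivations gives functionals on `I ⊗ K` (`foxDual`), the components of a left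
inverse of `χ`. Their uniqueness gives surjectivity: a functional on `I ⊗ K` vanishing on the image
of `χ` corresponds to a derivation which vanishes at all `γ_i`. So the extended Fox derivatives are
the `K`-components of the homomorphisms `foxHom i : F_n^acy → K ⋊ H₁`.

The solution in `F_n^acy` of the acyclic equation
`x = (γ₂ x γ₂⁻¹) (γ₂² x⁻¹ γ₂⁻²) ⋯ (γ₂^{2m} x⁻¹ γ₂^{-2m}) γ₁` has `p_m ∂x/∂γ₁ = 1`
(`exists_altSum_mul_foxHom_left`). In a finitely generated group with a homomorphism to `K ⋊ H₁`, all
`K`-components have a common denominator `q`, and here `q` would be divisible by all `p_m`. As `K ⋊ H₁`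
is metabelian, this applies to the metabelian quotient of `F_n^acy` as well.

For the arithmetic of `p_m`, write `ℤ[H₁]` as a group ring over `ℤ[γ₂, γ₂⁻¹]` and evaluate at
`γ₂ = -ζ`, where `ζ` is a primitive root of unity of prime order `2m + 1`. The values lie in the
domain `ℂ[H₁]`, and the kernel is generated by `p_m` (`splitEval_eq_zero_iff`). Hence `p_m` is prime,
and an element divisible by all these `p_m` vanishes, because its coefficients have infinitely many
roots.
-/

/-! ### The semidirect product `K ⋊ H` is acyclically closed -/

/-- The augmentation `ℤ[H] → ℤ`. -/
noncomputable def augmentation (H : Type*) [CommGroup H] : MonoidAlgebra ℤ H →+* ℤ :=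
  (MonoidAlgebra.lift ℤ ℤ H 1).toRingHom

@[simp] theorem augmentation_of {H : Type*} [CommGroup H] (h : H) :
    augmentation H (MonoidAlgebra.of ℤ H h) = 1 := by
  simp [augmentation]

/-- The semidirect product `K ⋊ H`, where `h : H` acts on the ring `K` as multiplication by
`ρ h`, with multiplication `(a, h) (b, k) = (a + ρ(h) b, h k)`. Homomorphisms from a group to
`K ⋊ H` are the same as homomorphisms `π` to `H` together with Fox derivations over `π`,
the latter being the first component. -/
@[ext] structure AffineGroup {H K : Type*} [CommGroup H] [CommRing K]
    (ρ : MonoidAlgebra ℤ H →+* K) where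
  /-- The component in `K`. -/
  left : K
  /-- The component in `H`. -/
  right : H

namespace AffineGroup

section CommRing

variable {H K : Type*} [CommGroup H] [CommRing K] {ρ : MonoidAlgebra ℤ H →+* K}

noncomputable instance : Mul (AffineGroup ρ) :=
  ⟨fun x y => ⟨x.left + ρ (MonoidAlgebra.of ℤ H x.right) * y.left, x.right * y.right⟩⟩

instance : One (AffineGroup ρ) := ⟨⟨0, 1⟩⟩

noncomputable instance : Inv (AffineGroup ρ) :=
  ⟨fun x => ⟨-(ρ (MonoidAlgebra.of ℤ H x.right⁻¹) * x.left), x.right⁻¹⟩⟩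

@[simp] theorem mul_left (x y : AffineGroup ρ) :
    (x * y).left = x.left + ρ (MonoidAlgebra.of ℤ H x.right) * y.left := rfl

@[simp] theorem mul_right (x y : AffineGroup ρ) : (x * y).right = x.right * y.right := rfl

@[simp] theorem one_left : (1 : AffineGroup ρ).left = 0 := rfl

@[simp] theorem one_right : (1 : AffineGroup ρ).right = 1 := rfl

@[simp] theorem inv_left (x : AffineGroup ρ) :
    x⁻¹.left = -(ρ (MonoidAlgebra.of ℤ H x.right⁻¹) * x.left) := rfl

@[simp] theorem inv_right (x : AffineGroup ρ) : x⁻¹.right = x.right⁻¹ := rfl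

noncomputable instance : Group (AffineGroup ρ) where
  mul_assoc x y z := by
    ext
    · simp only [mul_left, mul_right, map_mul]; ring
    · simp [mul_assoc]
  one_mul x := by
    ext
    · simp only [mul_left, one_left, one_right, map_one]; ring
    · simp
  mul_one x := by ext <;> simp
  inv_mul_cancel x := by ext <;> simp

variable (ρ) in
/-- The projection `K ⋊ H → H`. -/
def rightHom : AffineGroup ρ →* H where
  toFun := right
  map_one' := rfl
  map_mul' _ _ := rfl

@[simp] theorem rightHom_apply (x : AffineGroup ρ) : rightHom ρ x = x.right := rfl

/-- `K ⋊ H` is metabelian, as its commutator subgroup is contained in the abelian group `K`. -/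
theorem map_derived_eq_one {Q : Type*} [Group Q] (f : Q →* AffineGroup ρ) :
    ⁅commutator Q, commutator Q⁆ ≤ f.ker := by
  have h : ∀ g ∈ commutator Q, (f g).right = 1 := fun g hg =>
    Abelianization.commutator_subset_ker ((rightHom ρ).comp f) hg
  refine Subgroup.commutator_le.mpr fun a ha b hb => ?_
  rw [MonoidHom.mem_ker, map_commutatorElement, commutatorElement_eq_one_iff_mul_comm]
  ext
  · simp only [mul_left, h a ha, h b hb, map_one]; ring
  · simp [h a ha, h b hb]

end CommRing

section Words

variable {H K : Type u} [CommGroup H] [CommRing K] {ρ : MonoidAlgebra ℤ H →+* K} {m : ℕ}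

/-- The exponent sum of the variable `x_i` in a word. -/
def exponentSum (i : Fin m) : FreeGroup (Fin m) →* Multiplicative ℤ :=
  FreeGroup.lift fun j => Multiplicative.ofAdd (if j = i then 1 else 0)

/-- A word over `K ⋊ H` is affine if, once the `H`-components `h i` of the variables are fixed, its
`K`-component is an affine function of the `K`-components of the variables. Its linear coefficients
are required to be images of elements `α i` of the group ring (the Fox derivatives of the word)
whose augmentations are the exponent sums. -/
def IsAffineWord (h : Fin m → H) (w : Monoid.Coprod (AffineGroup ρ) (FreeGroup (Fin m))) : Prop :=
  ∃ (b : K) (r : H) (α : Fin m → MonoidAlgebra ℤ H),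
    (∀ i, augmentation H (α i) = (exponentSum i (Monoid.Coprod.snd w)).toAdd) ∧
    ∀ x : Fin m → AffineGroup ρ, (∀ i, (x i).right = h i) →
      Monoid.Coprod.lift (MonoidHom.id _) (FreeGroup.lift x) w =
        ⟨b + ∑ i, ρ (α i) * (x i).left, r⟩

theorem IsAffineWord.mul {h : Fin m → H}
    {u v : Monoid.Coprod (AffineGroup ρ) (FreeGroup (Fin m))}
    (hu : IsAffineWord h u) (hv : IsAffineWord h v) : IsAffineWord h (u * v) := by
  obtain ⟨b, r, α, hα, hx⟩ := hu
  obtain ⟨b', r', α', hα', hx'⟩ := hv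
  refine ⟨b + ρ (MonoidAlgebra.of ℤ H r) * b', r * r',
    fun i => α i + MonoidAlgebra.of ℤ H r * α' i, fun i => ?_, fun x h => ?_⟩
  · rw [map_add, map_mul, augmentation_of, hα, hα']; simp
  · rw [map_mul, hx x h, hx' x h]
    ext
    · simp only [mul_left, map_add, map_mul, add_mul, Finset.sum_add_distrib, mul_add,
        Finset.mul_sum, mul_assoc]
      ring
    · rfl

theorem isAffineWord (h : Fin m → H) (w : Monoid.Coprod (AffineGroup ρ) (FreeGroup (Fin m))) :
    IsAffineWord h w := by
  induction w using Monoid.Coprod.induction_on with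
  | inl a => exact ⟨a.left, a.right, 0, by simp, fun x _ => by simp⟩
  | inr v =>
    induction v using FreeGroup.induction_on with
    | C1 => exact ⟨0, 1, 0, by simp, fun x _ => by simp; rfl⟩
    | of j =>
      refine ⟨0, h j, fun i => if j = i then 1 else 0, fun i => ?_, fun x hx => ?_⟩
      · by_cases hij : j = i <;> simp [exponentSum, hij]
      · ext <;> simp [← hx j, apply_ite ρ]
    | inv_of j _ =>
      refine ⟨0, (h j)⁻¹, fun i => if j = i then -MonoidAlgebra.of ℤ H (h j)⁻¹ else 0,
        fun i => ?_, fun x hx => ?_⟩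
      · by_cases hij : j = i
        · simp only [hij, if_true, map_neg, augmentation_of]; simp [exponentSum]
        · simp [exponentSum, hij]
      · ext <;> simp [← hx j, apply_ite ρ]
    | mul u v hu hv => rw [map_mul]; exact hu.mul hv
  | mul u v hu hv => exact hu.mul hv

end Words

/-- If the elements of augmentation `1` do not vanish in the field `K`, then `K ⋊ H` is acyclically
closed: the `H`-components of the solution of an acyclic system are determined in the abelian
group `H`, and then its `K`-components solve a linear system whose matrix reduces to the identity
under the augmentation. -/
theorem isAC {H K : Type u} [CommGroup H] [Field K] {ρ : MonoidAlgebra ℤ H →+* K}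
    (hρ : ∀ r, augmentation H r = 1 → ρ r ≠ 0) : IsAC (AffineGroup ρ) := by
  refine isAC_iff_tuple.mpr fun m w hw => ?_
  -- The induced system in `H`, of which the solution `h` consists of the `H`-components.
  let w' : Fin m → Monoid.Coprod H (FreeGroup (Fin m)) := fun i =>
    Monoid.Coprod.map (rightHom ρ) (MonoidHom.id _) (w i)
  have hsnd : (Monoid.Coprod.snd.comp (Monoid.Coprod.map (rightHom ρ) (MonoidHom.id _)) :
      Monoid.Coprod (AffineGroup ρ) (FreeGroup (Fin m)) →* FreeGroup (Fin m)) =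
      Monoid.Coprod.snd := by
    refine Monoid.Coprod.hom_ext ?_ ?_ <;> ext <;> simp
  have hright : ∀ (x : Fin m → AffineGroup ρ) (i : Fin m),
      (Monoid.Coprod.lift (MonoidHom.id _) (FreeGroup.lift x) (w i)).right =
        Monoid.Coprod.lift (MonoidHom.id H) (FreeGroup.lift fun j => (x j).right) (w' i) := by
    intro x i
    have : (rightHom ρ).comp (Monoid.Coprod.lift (MonoidHom.id _) (FreeGroup.lift x)) =
        (Monoid.Coprod.lift (MonoidHom.id H) (FreeGroup.lift fun j => (x j).right)).comp
          (Monoid.Coprod.map (rightHom ρ) (MonoidHom.id _)) := by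
      refine Monoid.Coprod.hom_ext ?_ ?_ <;> ext <;> simp
    exact DFunLike.congr_fun this (w i)
  obtain ⟨h, hh, huniq⟩ := isAC_iff_tuple.mp (isAC_of_commGroup H) m w' fun i => by
    have := hw i
    rw [IsAcyclicWord, MonoidHom.mem_ker, MonoidHom.comp_apply] at this ⊢
    rwa [← MonoidHom.comp_apply Monoid.Coprod.snd, hsnd]
  choose b r α hα hx using fun i => isAffineWord (ρ := ρ) h (w i)
  have hr : ∀ i, r i = h i := by
    intro i
    have h1 := congrArg right (hx i (fun j => ⟨0, h j⟩) fun _ => rfl)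
    rw [hright] at h1
    exact h1.symm.trans (hh i).symm
  have hα0 : ∀ i j, augmentation H (α i j) = 0 := by
    intro i j
    have h1 : exponentSum j = (Abelianization.lift (exponentSum j)).comp
        (Abelianization.of (G := FreeGroup (Fin m))) := by ext; simp
    have h2 := hw i
    rw [IsAcyclicWord, MonoidHom.mem_ker, MonoidHom.comp_apply] at h2
    rw [hα, h1, MonoidHom.comp_apply, h2, map_one, toAdd_one]
  let N : Matrix (Fin m) (Fin m) (MonoidAlgebra ℤ H) := 1 - Matrix.of α
  have hdet : IsUnit (ρ.mapMatrix N).det := by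
    rw [← RingHom.map_det]
    refine (hρ _ ?_).isUnit
    rw [RingHom.map_det]
    have : (augmentation H).mapMatrix N = 1 := by
      ext i j
      simp [N, Matrix.one_apply, hα0, apply_ite]
    rw [this, Matrix.det_one]
  have hN : ∀ y : Fin m → K, (ρ.mapMatrix N).mulVec y = b ↔
      ∀ i, y i = b i + ∑ j, ρ (α i j) * y j := by
    intro y
    have : ρ.mapMatrix N = 1 - Matrix.of fun i j => ρ (α i j) := by
      ext i j
      simp [N, Matrix.one_apply, apply_ite]
    rw [this, Matrix.sub_mulVec, Matrix.one_mulVec, sub_eq_iff_eq_add, funext_iff]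
    rfl
  have hsol : ∀ x : Fin m → AffineGroup ρ, (∀ i, (x i).right = h i) →
      ((∀ i, x i = Monoid.Coprod.lift (MonoidHom.id _) (FreeGroup.lift x) (w i)) ↔
        (ρ.mapMatrix N).mulVec (fun i => (x i).left) = b) := by
    intro x hxh
    rw [hN]
    refine forall_congr' fun i => ?_
    rw [hx i x hxh, AffineGroup.ext_iff]
    exact and_iff_left ((hxh i).trans (hr i).symm)
  refine ⟨fun i => ⟨((ρ.mapMatrix N)⁻¹.mulVec b) i, h i⟩, ?_, fun x hxs => ?_⟩
  · refine (hsol _ fun _ => rfl).mpr ?_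
    change (ρ.mapMatrix N).mulVec ((ρ.mapMatrix N)⁻¹.mulVec b) = b
    rw [Matrix.mulVec_mulVec, Matrix.mul_nonsing_inv _ hdet, Matrix.one_mulVec]
  · have hxh : ∀ i, (x i).right = h i := congrFun (huniq _ fun i => by
      rw [← hright, ← hxs i])
    have h1 := (hsol x hxh).mp hxs
    funext i
    ext
    · rw [← h1, Matrix.mulVec_mulVec, Matrix.nonsing_inv_mul _ hdet, Matrix.one_mulVec]
    · exact hxh i

end AffineGroup

/-! ### The elements `1 - h + h² - … + h^{2m}` of the group ring -/

open Polynomial in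
/-- An integral polynomial which vanishes at `-ζ`, for a primitive `p`-th root of unity `ζ`, is
divisible by `Φ_p(-X)`. -/
theorem sum_neg_X_pow_dvd {p : ℕ} (hp : p.Prime) {ζ : ℂ} (hζ : IsPrimitiveRoot ζ p) {f : ℤ[X]}
    (hf : aeval (-ζ) f = 0) : ∑ k ∈ Finset.range p, (-X : ℤ[X]) ^ k ∣ f := by
  have := Fact.mk hp
  have h1 : cyclotomic p ℤ ∣ f.comp (-X) := by
    rw [cyclotomic_eq_minpoly hζ hp.pos]
    refine minpoly.isIntegrallyClosed_dvd (hζ.isIntegral hp.pos) ?_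
    rw [aeval_comp]
    simpa using hf
  obtain ⟨g, hg⟩ := h1
  refine ⟨g.comp (-X), ?_⟩
  have h2 := congrArg (fun q => q.comp (-X)) hg
  simpa [comp_assoc, cyclotomic_prime] using h2

section GradedGroupRing

open LaurentPolynomial

variable {H : Type*} [CommGroup H] (g : H) (e : H →* Multiplicative ℤ)

/-- For a homomorphism `e : H → ℤ` and `g : H`, the ring homomorphism `ℤ[H] → ℤ[T;T⁻¹][H]` which
sends `h` to `h g^{-e(h)} T^{e(h)}`. If `e g = 1`, this is the presentation of `ℤ[H]` as a group
ring of `H / ⟨g⟩ ≅ ker e` over `ℤ[g, g⁻¹]`. -/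
noncomputable def splitOff : MonoidAlgebra ℤ H →+* MonoidAlgebra ℤ[T;T⁻¹] H :=
  (MonoidAlgebra.lift ℤ (MonoidAlgebra ℤ[T;T⁻¹] H) H
    { toFun := fun h => MonoidAlgebra.single (h * g ^ (-(e h).toAdd)) (T (e h).toAdd)
      map_one' := by simp [MonoidAlgebra.one_def]
      map_mul' := fun h k => by
        rw [MonoidAlgebra.single_mul_single, ← T_add, map_mul, toAdd_mul, neg_add, zpow_add]
        congr 1
        exact mul_mul_mul_comm _ _ _ _ }).toRingHom

theorem splitOff_of (h : H) : splitOff g e (MonoidAlgebra.of ℤ H h) =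
    MonoidAlgebra.single (h * g ^ (-(e h).toAdd)) (T (e h).toAdd) := by
  simp [splitOff]

/-- The ring homomorphism `ℤ[T;T⁻¹][H] → ℤ[H]` which is the identity on `H` and sends `T` to `g`. -/
noncomputable def substitute : MonoidAlgebra ℤ[T;T⁻¹] H →+* MonoidAlgebra ℤ H :=
  MonoidAlgebra.liftNCRingHom
    (LaurentPolynomial.eval₂ (Int.castRingHom _) ((toUnits g).map (MonoidAlgebra.of ℤ H)))
    (MonoidAlgebra.of ℤ H) fun _ _ => Commute.all _ _

theorem substitute_single (h : H) (c : ℤ[T;T⁻¹]) : substitute g (MonoidAlgebra.single h c) =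
    LaurentPolynomial.eval₂ (Int.castRingHom _) ((toUnits g).map (MonoidAlgebra.of ℤ H)) c *
      MonoidAlgebra.of ℤ H h :=
  MonoidAlgebra.liftNCRingHom_single _ _ _ _ _

theorem substitute_splitOff (a : MonoidAlgebra ℤ H) : substitute g (splitOff g e a) = a := by
  induction a using MonoidAlgebra.induction_on with
  | of h =>
    rw [splitOff_of, substitute_single, eval₂_T, ← map_zpow, Units.coe_map, ← map_zpow]
    change MonoidAlgebra.of ℤ H (g ^ _) * _ = _
    rw [← map_mul]
    rw [mul_left_comm, zpow_neg, mul_inv_cancel, mul_one]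
  | add a b ha hb => rw [map_add, map_add, ha, hb]
  | smul r a ha => rw [map_zsmul, map_zsmul, ha]

theorem sum_neg_pow_dvd_substitute {p : ℕ} {b : MonoidAlgebra ℤ[T;T⁻¹] H}
    (hb : ∀ h, Polynomial.toLaurent (∑ k ∈ Finset.range p, (-Polynomial.X) ^ k) ∣ b.coeff h) :
    ∑ k ∈ Finset.range p, (-MonoidAlgebra.of ℤ H g) ^ k ∣ substitute g b := by
  have h1 : b = ∑ h ∈ b.coeff.support, MonoidAlgebra.single h (b.coeff h) := by
    exact (MonoidAlgebra.sum_coeff_single b).symm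
  rw [h1, map_sum]
  refine Finset.dvd_sum fun h _ => ?_
  obtain ⟨c, hc⟩ := hb h
  rw [substitute_single, hc, map_mul, eval₂_toLaurent, mul_assoc]
  refine Dvd.intro _ (congrArg (· * _) ?_)
  simp [Polynomial.eval₂_finsetSum, Polynomial.eval₂_pow]

/-- The composition of `splitOff` with the evaluation of Laurent polynomials at `T = u`. -/
noncomputable def splitEval (u : ℂˣ) : MonoidAlgebra ℤ H →+* MonoidAlgebra ℂ H :=
  (MonoidAlgebra.mapRingHom H (LaurentPolynomial.eval₂ (Int.castRingHom ℂ) u)).comp (splitOff g e)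

theorem splitEval_of_self (he : e g = Multiplicative.ofAdd 1) (u : ℂˣ) :
    splitEval g e u (MonoidAlgebra.of ℤ H g) = algebraMap ℂ _ (u : ℂ) := by
  rw [splitEval, RingHom.comp_apply, splitOff_of, he]
  simp

variable {g e}

/-- The kernel of `splitEval` at `-ζ`, for a primitive `p`-th root of unity `ζ`, is generated by
`1 - g + g² - …`. -/
theorem splitEval_eq_zero_iff (he : e g = Multiplicative.ofAdd 1) {p : ℕ} (hp : p.Prime) {u : ℂˣ}
    (hu : IsPrimitiveRoot (-(u : ℂ)) p) {a : MonoidAlgebra ℤ H} :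
    splitEval g e u a = 0 ↔ ∑ k ∈ Finset.range p, (-MonoidAlgebra.of ℤ H g) ^ k ∣ a := by
  constructor
  · intro ha
    rw [← substitute_splitOff g e a]
    refine sum_neg_pow_dvd_substitute g fun h => ?_
    set c := (splitOff g e a).coeff h with hc
    have h0 : LaurentPolynomial.eval₂ (Int.castRingHom ℂ) u c = 0 := by
      rw [hc, ← MonoidAlgebra.coeff_mapRingHom]
      exact congrArg (fun x => MonoidAlgebra.coeff x h) ha
    obtain ⟨n, f, hf⟩ := exists_T_pow c
    have h1 : Polynomial.aeval (-(-(u : ℂ))) f = 0 := by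
      have := congrArg (LaurentPolynomial.eval₂ (Int.castRingHom ℂ) u) hf
      rw [map_mul, h0, zero_mul, eval₂_toLaurent] at this
      rw [neg_neg]
      exact this
    obtain ⟨q, rfl⟩ := sum_neg_X_pow_dvd hp hu h1
    refine ⟨Polynomial.toLaurent q * T (-n), ?_⟩
    rw [← mul_assoc, ← map_mul, hf, mul_assoc, ← T_add, add_neg_cancel, T_zero, mul_one]
  · rintro ⟨b, rfl⟩
    have : ∑ k ∈ Finset.range p, (-(u : ℂ)) ^ k = 0 := hu.geom_sum_eq_zero hp.one_lt
    rw [map_mul, map_sum]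
    simp only [map_pow, map_neg, splitEval_of_self g e he]
    simp only [← map_neg, ← map_pow, ← map_sum, this, map_zero, zero_mul]

theorem prime_sum_neg_pow [UniqueProds H] (he : e g = Multiplicative.ofAdd 1) {p : ℕ}
    (hp : p.Prime) (hp2 : p ≠ 2) :
    Prime (∑ k ∈ Finset.range p, (-MonoidAlgebra.of ℤ H g) ^ k) := by
  have hζ := Complex.isPrimitiveRoot_exp p hp.ne_zero
  let u : ℂˣ := -(hζ.isUnit hp.ne_zero).unit
  have hu : IsPrimitiveRoot (-(u : ℂ)) p := by simpa [u] using hζ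
  refine ⟨fun h => ?_, fun h => ?_, fun a b hab => ?_⟩
  · have h1 := congrArg (augmentation H) h
    have h2 : ¬ Even p := fun h => hp2 ((hp.even_iff).mp h)
    simp [-MonoidAlgebra.of_apply, neg_one_geom_sum, h2] at h1
  · have := (splitEval_eq_zero_iff he hp hu (a := 1)).mpr h.dvd
    rw [map_one] at this
    exact one_ne_zero this
  · simp only [← splitEval_eq_zero_iff he hp hu, map_mul] at hab ⊢
    exact mul_eq_zero.mp hab

/-- An element with infinitely many of the divisors `1 - g + … + g^{p-1}` vanishes, since its
coefficients over `ℤ[g, g⁻¹]` have infinitely many roots. -/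
theorem eq_zero_of_forall_sum_neg_pow_dvd (he : e g = Multiplicative.ofAdd 1)
    {q : MonoidAlgebra ℤ H}
    (hq : ∀ p : ℕ, p.Prime → p ≠ 2 → ∑ k ∈ Finset.range p, (-MonoidAlgebra.of ℤ H g) ^ k ∣ q) :
    q = 0 := by
  rw [← substitute_splitOff g e q]
  suffices splitOff g e q = 0 by rw [this, map_zero]
  ext h : 2
  set c := (splitOff g e q).coeff h with hc
  obtain ⟨n, f, hf⟩ := exists_T_pow c
  suffices f.map (Int.castRingHom ℂ) = 0 by
    rw [Polynomial.map_eq_zero_iff (RingHom.injective_int _)] at this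
    rw [this, map_zero] at hf
    have := congrArg (· * T (-n)) hf
    simp only [zero_mul, mul_assoc, ← T_add, add_neg_cancel, T_zero, mul_one] at this
    exact this.symm
  have hinf : {p : ℕ | p.Prime ∧ p ≠ 2}.Infinite :=
    Nat.infinite_setOfPred_prime.sdiff (Set.finite_singleton 2)
  refine Polynomial.eq_zero_of_infinite_isRoot _ ((hinf.image (f := fun p : ℕ =>
    -Complex.exp (2 * Real.pi * Complex.I / p)) ?_).mono ?_)
  · intro p hp p' hp' hpp
    have h1 := Complex.isPrimitiveRoot_exp p hp.1.ne_zero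
    rw [neg_injective hpp] at h1
    exact h1.unique (Complex.isPrimitiveRoot_exp p' hp'.1.ne_zero)
  · rintro _ ⟨p, ⟨hp, hp2⟩, rfl⟩
    have hζ := Complex.isPrimitiveRoot_exp p hp.ne_zero
    let u : ℂˣ := -(hζ.isUnit hp.ne_zero).unit
    have hu : IsPrimitiveRoot (-(u : ℂ)) p := by simpa [u] using hζ
    have h0 : LaurentPolynomial.eval₂ (Int.castRingHom ℂ) u c = 0 := by
      rw [hc, ← MonoidAlgebra.coeff_mapRingHom]
      exact congrArg (fun x => MonoidAlgebra.coeff x h)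
        ((splitEval_eq_zero_iff he hp hu).mpr (hq p hp hp2))
    have := congrArg (LaurentPolynomial.eval₂ (Int.castRingHom ℂ) u) hf
    rw [map_mul, h0, zero_mul, eval₂_toLaurent] at this
    simpa [Polynomial.eval_map, u] using this

end GradedGroupRing

/-! ### Fox derivations on the acyclic closure -/

section BaseChange

open scoped TensorProduct

variable {K I : Type*} [CommRing K] [AddCommGroup I]

/-- The extension of scalars of an additive map. It is defined for an abstract ring `K`, because
`K_{H₁}` carries a second `ℤ`-module structure, as a localization, which is not reducibly the
same. -/
noncomputable def extendScalars (l : I →+ K) : K ⊗[ℤ] I →ₗ[K] K :=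
  LinearMap.liftBaseChange K l.toIntLinearMap

theorem extendScalars_tmul (l : I →+ K) (a : K) (x : I) : extendScalars l (a ⊗ₜ x) = a * l x := by
  simp [extendScalars]

theorem extendScalars_ext {f g : K ⊗[ℤ] I →ₗ[K] K} (h : ∀ a x, f (a ⊗ₜ x) = g (a ⊗ₜ x)) : f = g :=
  TensorProduct.AlgebraTensorModule.ext h

end BaseChange

section Fox

variable {n : ℕ}

/-- The semidirect product `K_{H₁} ⋊ H₁`. -/
abbrev FoxGroup (n : ℕ) : Type :=
  AffineGroup (algebraMap (MonoidAlgebra ℤ (FreeH1 n)) (KField n))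

theorem isAC_foxGroup : IsAC (FoxGroup n) := by
  refine AffineGroup.isAC fun r hr h => ?_
  rw [FaithfulSMul.algebraMap_eq_zero_iff] at h
  simp [h] at hr

/-- The homomorphism `F_n^acy → K_{H₁} ⋊ H₁` which sends `γ_i` to `(1, γ_i)` and `γ_j` to
`(0, γ_j)` for `j ≠ i`. Its first component is the Fox derivation `∂/∂γ_i`. -/
noncomputable def foxHom (i : Fin n) : FAcy n →* FoxGroup n :=
  AcyclicClosure.lift isAC_foxGroup
    (FreeGroup.lift fun j => ⟨if j = i then 1 else 0, Abelianization.of (FreeGroup.of j)⟩)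

theorem foxHom_gam (i j : Fin n) : foxHom i (gam j) =
    ⟨if j = i then 1 else 0, Abelianization.of (FreeGroup.of j)⟩ := by
  simp [foxHom, gam, ← MonoidHom.comp_apply, -MonoidHom.coe_comp, AcyclicClosure.lift_comp_ι]

theorem foxHom_right (i : Fin n) (v : FAcy n) : (foxHom i v).right = toH1 n v := by
  have : (AffineGroup.rightHom _).comp (foxHom i) = toH1 n := by
    refine AcyclicClosure.hom_ext (isAC_of_commGroup _) ?_
    ext j
    exact congrArg AffineGroup.right (foxHom_gam i j)
  exact DFunLike.congr_fun this v

theorem toK_of (v : FAcy n) : toK n (MonoidAlgebra.of ℤ _ v) =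
    algebraMap _ _ (MonoidAlgebra.of ℤ _ (toH1 n v)) := by
  simp [toK]

theorem trivializer_of (v : FAcy n) : trivializer n (MonoidAlgebra.of ℤ _ v) = 1 := by
  simp [trivializer]

theorem bar_of (h : FreeH1 n) : bar n (algebraMap _ _ (MonoidAlgebra.of ℤ _ h)) =
    algebraMap _ _ (MonoidAlgebra.of ℤ _ h⁻¹) := by
  rw [bar, IsFractionRing.ringEquivOfRingEquiv_algebraMap]
  simp

theorem bar_bar (x : KField n) : bar n (bar n x) = x := by
  have : ((bar n).toRingHom.comp (bar n).toRingHom).comp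
      (algebraMap (MonoidAlgebra ℤ (FreeH1 n)) (KField n)) = algebraMap _ _ := by
    refine MonoidAlgebra.ringHom_ext (fun r => ?_) fun h => ?_
    · have : (MonoidAlgebra.single 1 r : MonoidAlgebra ℤ (FreeH1 n)) = (r : ℤ) := by
        rw [← zsmul_one, MonoidAlgebra.one_def, MonoidAlgebra.smul_single]; simp
      rw [this, map_intCast, map_intCast]
    · have := bar_of h⁻¹
      rw [inv_inv, ← bar_of h] at this
      exact this
  have h2 : (bar n).toRingHom.comp (bar n).toRingHom = RingHom.id _ :=
    IsLocalization.ringHom_ext (nonZeroDivisors (MonoidAlgebra ℤ (FreeH1 n))) this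
  exact DFunLike.congr_fun h2 x

/-- The additive map `ℤ[F_n^acy] → K_{H₁}` with `v⁻¹ ↦ bar (∂v/∂γ_i)`. -/
noncomputable def foxAddHom (i : Fin n) : MonoidAlgebra ℤ (FAcy n) →+ KField n :=
  MonoidAlgebra.liftNC (Int.castAddHom _) fun v => bar n (foxHom i v⁻¹).left

theorem foxAddHom_of (i : Fin n) (v : FAcy n) :
    foxAddHom i (MonoidAlgebra.of ℤ _ v) = bar n (foxHom i v⁻¹).left := by
  simp [foxAddHom]

/-- The derivation rule. For `x` in the augmentation ideal the first summand vanishes, so that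
`foxAddHom i` is compatible with the right action of `ℤ[F_n^acy]` there. -/
theorem foxAddHom_mul (i : Fin n) (x r : MonoidAlgebra ℤ (FAcy n)) :
    foxAddHom i (x * r) = trivializer n x * foxAddHom i r + toK n r * foxAddHom i x := by
  induction x using MonoidAlgebra.induction_on with
  | add x y hx hy => rw [add_mul, map_add, map_add, map_add, hx, hy]; push_cast; ring
  | smul k x hx =>
    rw [smul_mul_assoc, map_zsmul, map_zsmul, map_zsmul, hx]
    simp only [zsmul_eq_mul, Int.cast_mul, Int.cast_eq]; ring
  | of v =>
    induction r using MonoidAlgebra.induction_on with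
    | add x y hx hy => rw [mul_add, map_add, map_add, map_add, hx, hy]; ring
    | smul k x hx =>
      rw [mul_smul_comm, map_zsmul, map_zsmul, map_zsmul, hx]
      simp only [zsmul_eq_mul]; ring
    | of u =>
      rw [← map_mul, foxAddHom_of, foxAddHom_of, foxAddHom_of, trivializer_of, toK_of, mul_inv_rev,
        map_mul, AffineGroup.mul_left, foxHom_right, map_add, map_mul, bar_of, map_inv (toH1 n),
        inv_inv]
      simp

open scoped TensorProduct in
/-- The `K_{H₁}`-linear map `I ⊗ K_{H₁} → K_{H₁}` with `(v⁻¹ - 1) ⊗ a ↦ bar (∂v/∂γ_i) a`, a component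
of the inverse of `χ`. -/
noncomputable def foxDual (i : Fin n) : AugTensor n →ₗ[KField n] KField n :=
  Submodule.liftQ _ (extendScalars ((foxAddHom i).comp (augIdeal n).toAddSubgroup.subtype)) <| by
    refine Submodule.span_le.mpr ?_
    rintro _ ⟨x, r, a, rfl⟩
    have hx : trivializer n x = 0 := x.2
    have h : foxAddHom i (augMul x r : augIdeal n) = toK n r * foxAddHom i x := by
      rw [augMul, foxAddHom_mul, hx]; simp
    rw [SetLike.mem_coe, LinearMap.mem_ker, map_sub, extendScalars_tmul, extendScalars_tmul]
    change a * foxAddHom i (augMul x r : augIdeal n) - toK n r * a * foxAddHom i x = 0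
    rw [h]; ring

theorem foxDual_augTmul (i : Fin n) (v : FAcy n) (a : KField n) :
    foxDual i (augTmul (invSubOne v) a) = a * bar n (foxHom i v).left := by
  have h : foxAddHom i (invSubOne v : augIdeal n) = bar n (foxHom i v).left := by
    rw [invSubOne, map_sub, foxAddHom_of, inv_inv, ← map_one (MonoidAlgebra.of ℤ (FAcy n)),
      foxAddHom_of]
    simp
  rw [← h]
  exact extendScalars_tmul _ _ _

theorem foxDual_chi (i : Fin n) (a : Fin n → KField n) : foxDual i (chi n a) = a i := by
  simp [chi, foxDual_augTmul, foxHom_gam, apply_ite (bar n)]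

theorem augTmul_add (x y : augIdeal n) (a : KField n) :
    augTmul (x + y) a = augTmul x a + augTmul y a := by
  rw [augTmul, TensorProduct.tmul_add]; rfl

theorem augTmul_smul (x : augIdeal n) (a c : KField n) :
    augTmul x (c * a) = c • augTmul x a := rfl

theorem augTmul_augMul (x : augIdeal n) (r : MonoidAlgebra ℤ (FAcy n)) (a : KField n) :
    augTmul (augMul x r) a = augTmul x (toK n r * a) :=
  (Submodule.Quotient.eq _).mpr (Submodule.subset_span ⟨x, r, a, rfl⟩)

/-- `v ↦ (v⁻¹ - 1) ⊗ 1` is a derivation for the action of `h : H₁` as multiplication by `h⁻¹`. -/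
theorem augTmul_invSubOne_mul (u v : FAcy n) :
    augTmul (invSubOne (u * v)) (1 : KField n) = augTmul (invSubOne u) 1 +
      algebraMap _ (KField n) (MonoidAlgebra.of ℤ _ (toH1 n u)⁻¹) •
        augTmul (invSubOne v) (1 : KField n) := by
  have : invSubOne (u * v) = invSubOne u + augMul (invSubOne v) (MonoidAlgebra.of ℤ _ u⁻¹) := by
    refine Subtype.ext ?_
    simp only [invSubOne, augMul, Submodule.coe_add, mul_inv_rev, map_mul]
    noncomm_ring
  rw [this, augTmul_add, augTmul_augMul, toK_of, map_inv, augTmul_smul]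

/-- The elements `v⁻¹ - 1` generate the augmentation ideal as an additive group. -/
theorem augIdeal_addHom_eq_zero {A : Type*} [AddCommGroup A] (F : augIdeal n →+ A)
    (hF : ∀ v, F (invSubOne v) = 0) (x : augIdeal n) : F x = 0 := by
  have hmem : ∀ y : MonoidAlgebra ℤ (FAcy n), y - (trivializer n y : ℤ) ∈ augIdeal n := by
    intro y
    simp [augIdeal, RingHom.mem_ker]
  have key : ∀ y : MonoidAlgebra ℤ (FAcy n), F ⟨_, hmem y⟩ = 0 := by
    intro y
    induction y using MonoidAlgebra.induction_on with
    | of v =>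
      refine Eq.trans (congrArg F (Subtype.ext ?_)) (hF v⁻¹)
      simp only [trivializer_of, invSubOne, inv_inv, Int.cast_one]
    | add x y hx hy =>
      have h := map_add F ⟨_, hmem x⟩ ⟨_, hmem y⟩
      rw [hx, hy, add_zero] at h
      refine Eq.trans (congrArg F (Subtype.ext ?_)) h
      simp only [map_add, Int.cast_add, Submodule.coe_add]; abel
    | smul k x hx =>
      have h := map_zsmul F k ⟨_, hmem x⟩
      rw [hx, smul_zero] at h
      refine Eq.trans (congrArg F (Subtype.ext ?_)) h
      change k • x - _ = k • (x - _)
      rw [map_zsmul, smul_sub, smul_eq_mul, Int.cast_mul, zsmul_eq_mul _ k, zsmul_eq_mul _ k]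
  have hx : trivializer n x = 0 := x.2
  refine Eq.trans (congrArg F (Subtype.ext ?_)) (key x)
  simp [hx]

theorem functional_eq_zero (f : AugTensor n →ₗ[KField n] KField n)
    (hf : ∀ v, f (augTmul (invSubOne v) 1) = 0) : f = 0 := by
  let F : augIdeal n →+ KField n :=
    AddMonoidHom.mk' (fun x => f (augTmul x 1)) fun x y => by rw [augTmul_add, map_add]
  refine Submodule.linearMap_qext _ (extendScalars_ext fun a x => ?_)
  have h1 : f (augTmul x (a * 1)) = 0 := by
    rw [augTmul_smul, map_smul, show f (augTmul x 1) = 0 from augIdeal_addHom_eq_zero F hf x,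
      smul_zero]
  rw [mul_one] at h1
  exact h1

/-- The elements `(γ_i⁻¹ - 1) ⊗ 1` span `I ⊗ K_{H₁}`: a functional `f` which vanishes at them gives
rise to a derivation `v ↦ bar (f ((v⁻¹ - 1) ⊗ 1))` on `F_n^acy` which vanishes on the generators
`γ_i`, and hence everywhere, since `K_{H₁} ⋊ H₁` is acyclically closed. -/
theorem span_gam_eq_top : Submodule.span (KField n)
    (Set.range fun i : Fin n => augTmul (invSubOne (gam i)) (1 : KField n)) = ⊤ := by
  by_contra hne
  obtain ⟨f, hf0, hf⟩ := Submodule.exists_le_ker_of_lt_top _ (lt_top_iff_ne_top.mpr hne)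
  refine hf0 (functional_eq_zero f fun v => ?_)
  let φ : FAcy n →* FoxGroup n := MonoidHom.mk'
    (fun v => ⟨bar n (f (augTmul (invSubOne v) 1)), toH1 n v⟩) fun u v => by
      ext
      · rw [augTmul_invSubOne_mul, map_add, map_smul, map_add, smul_eq_mul, map_mul, bar_of,
          inv_inv]
        rfl
      · exact map_mul _ _ _
  let ψ : FAcy n →* FoxGroup n := MonoidHom.mk' (fun v => ⟨0, toH1 n v⟩) fun u v => by
    ext <;> simp
  have h : φ = ψ := by
    refine AcyclicClosure.hom_ext isAC_foxGroup ?_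
    ext j
    · have : f (augTmul (invSubOne (gam j)) 1) = 0 := hf (Submodule.subset_span ⟨j, rfl⟩)
      change bar n (f (augTmul (invSubOne (gam j)) 1)) = 0
      rw [this, map_zero]
    · rfl
  have h1 : bar n (f (augTmul (invSubOne v) 1)) = 0 :=
    congrArg AffineGroup.left (DFunLike.congr_fun h v)
  exact (map_eq_zero_iff _ (bar n).injective).mp h1

theorem chi_bijective (n : ℕ) : Function.Bijective (chi n) := by
  refine ⟨fun a b hab => ?_, fun x => ?_⟩
  · funext i
    rw [← foxDual_chi i a, hab, foxDual_chi]
  · have hx : x ∈ Submodule.span (KField n)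
        (Set.range fun i : Fin n => augTmul (invSubOne (gam i)) (1 : KField n)) := by
      rw [span_gam_eq_top]; trivial
    obtain ⟨c, hc⟩ := Submodule.mem_span_range_iff_exists_fun _ |>.mp hx
    refine ⟨c, hc ▸ Finset.sum_congr rfl fun i _ => ?_⟩
    rw [← augTmul_smul, mul_one]

/-- The extended Fox derivatives are the `K_{H₁}`-components of the homomorphisms `foxHom i`. -/
theorem foxDeriv_eq (i : Fin n) (v : FAcy n) : foxDeriv i v = (foxHom i v).left := by
  have h := Function.rightInverse_invFun (chi_bijective n).surjective
    (augTmul (invSubOne v) (1 : KField n))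
  have h1 := congrArg (foxDual i) h
  rw [foxDual_chi, foxDual_augTmul, one_mul] at h1
  rw [foxDeriv, h1, bar_bar]

end Fox

/-! ### Elements with prescribed denominators -/

/-- The product of the conjugates of `x, x⁻¹, …, x, x⁻¹` by `g, g², …, g^{2m-1}, g^{2m}`. -/
def altConj {G : Type*} [Group G] (g x : G) : ℕ → G
  | 0 => 1
  | m + 1 => altConj g x m * (g ^ (2 * m + 1) * x * (g ^ (2 * m + 1))⁻¹ *
      (g ^ (2 * m + 2) * x⁻¹ * (g ^ (2 * m + 2))⁻¹))

theorem map_altConj {G G' : Type*} [Group G] [Group G'] (f : G →* G') (g x : G) (m : ℕ) :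
    f (altConj g x m) = altConj (f g) (f x) m := by
  induction m with
  | zero => simp [altConj]
  | succ m ih => simp [altConj, ih]

theorem altConj_eq_one {G : Type*} [CommGroup G] (g x : G) (m : ℕ) : altConj g x m = 1 := by
  induction m with
  | zero => rfl
  | succ m ih => rw [altConj, ih, mul_inv_cancel_comm, mul_inv_cancel_comm]; simp

/-- In an acyclically closed group the equation `x = (∏ g^k x^{±1} g^{-k}) c` has a solution. -/
theorem IsAC.exists_eq_altConj_mul {G : Type u} [Group G] (hG : IsAC G) (g c : G) (m : ℕ) :
    ∃ x : G, x = altConj g x m * c := by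
  obtain ⟨x, hx, -⟩ := isAC_iff_tuple.mp hG 1
    (fun _ => altConj (Monoid.Coprod.inl g) (Monoid.Coprod.inr (FreeGroup.of 0)) m *
      Monoid.Coprod.inl c) fun _ => by
        rw [IsAcyclicWord, MonoidHom.mem_ker, map_mul, map_altConj, altConj_eq_one]
        simp
  refine ⟨x 0, (hx 0).trans ?_⟩
  rw [map_mul, map_altConj]
  simp

namespace AffineGroup

variable {H K : Type*} [CommGroup H] [CommRing K] {ρ : MonoidAlgebra ℤ H →+* K}

theorem pow_eq_of_left_eq_zero {g : AffineGroup ρ} (hg : g.left = 0) (k : ℕ) :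
    g ^ k = ⟨0, g.right ^ k⟩ := by
  induction k with
  | zero => simp; rfl
  | succ k ih => rw [pow_succ, ih]; ext <;> simp [hg, pow_succ]

theorem altConj_right (g x : AffineGroup ρ) (m : ℕ) : (altConj g x m).right = 1 := by
  rw [← rightHom_apply, map_altConj, altConj_eq_one]

/-- If `g` has trivial `K`-component, the Fox derivative of the word `altConj g x m` in `x` is
`g - g² + … - g^{2m}`. -/
theorem altConj_left {g : AffineGroup ρ} (hg : g.left = 0) (x : AffineGroup ρ) (m : ℕ) :
    (altConj g x m).left = (1 - ρ (∑ k ∈ Finset.range (2 * m + 1),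
      (-MonoidAlgebra.of ℤ H g.right) ^ k)) * x.left := by
  induction m with
  | zero => simp [altConj]
  | succ m ih =>
    rw [altConj, mul_left, ih, altConj_right, pow_eq_of_left_eq_zero hg,
      pow_eq_of_left_eq_zero hg, show 2 * (m + 1) + 1 = 2 * m + 1 + 1 + 1 by ring,
      Finset.sum_range_succ _ (2 * m + 1 + 1), Finset.sum_range_succ _ (2 * m + 1)]
    have h1 : (-MonoidAlgebra.of ℤ H g.right) ^ (2 * m + 1) =
        -MonoidAlgebra.of ℤ H g.right ^ (2 * m + 1) := Odd.neg_pow ⟨m, rfl⟩ _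
    have h2 : (-MonoidAlgebra.of ℤ H g.right) ^ (2 * m + 1 + 1) =
        MonoidAlgebra.of ℤ H g.right ^ (2 * m + 2) := Even.neg_pow ⟨m + 1, by ring⟩ _
    have h3 : MonoidAlgebra.of ℤ H x.right * MonoidAlgebra.of ℤ H x.right⁻¹ = 1 := by
      rw [← map_mul, mul_inv_cancel, map_one]
    have h4 : MonoidAlgebra.of ℤ H g.right * MonoidAlgebra.of ℤ H g.right⁻¹ = 1 := by
      rw [← map_mul, mul_inv_cancel, map_one]
    have h5 := congrArg ρ (congrArg (· ^ (2 * m + 1)) h4)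
    have h3 := congrArg ρ h3
    rw [h1, h2]
    simp only [mul_left, mul_right, inv_left, inv_right, map_mul, map_pow, map_one, map_add, map_neg,
      mul_pow, one_pow, ← inv_pow, zero_add, mul_zero, add_zero, neg_zero] at h3 h5 ⊢
    linear_combination (-ρ (MonoidAlgebra.of ℤ H g.right) ^ (2 * m + 2) * x.left) *
      (ρ (MonoidAlgebra.of ℤ H x.right) * ρ (MonoidAlgebra.of ℤ H x.right⁻¹) * h5 + h3)

end AffineGroup

/-- Solving `x = (∏ γ_j^k x^{±1} γ_j^{-k}) γ_i` over `1 ≤ k ≤ 2m` gives the Fox derivative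
`∂x/∂γ_i = (γ_j - γ_j² + … - γ_j^{2m}) ∂x/∂γ_i + 1`. -/
theorem exists_altSum_mul_foxHom_left {n : ℕ} {i j : Fin n} (hij : j ≠ i) (m : ℕ) :
    ∃ v : FAcy n, algebraMap _ (KField n) (altSum (Abelianization.of (FreeGroup.of j)) m) *
      (foxHom i v).left = 1 := by
  obtain ⟨v, hv⟩ := (AcyclicClosure.isAC (FreeGroup (Fin n))).exists_eq_altConj_mul
    (gam j) (gam i) m
  refine ⟨v, ?_⟩
  have h := congrArg (fun v => (foxHom i v).left) hv
  have hj : (foxHom i (gam j)).left = 0 := by simp [foxHom_gam, hij]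
  simp only [map_mul, map_altConj, AffineGroup.mul_left, AffineGroup.altConj_right] at h
  rw [AffineGroup.altConj_left hj] at h
  simp only [foxHom_gam, if_true, map_one] at h
  rw [altSum]
  linear_combination h

/-! ### Infinite generation -/

/-- A group of which the image in `K_{H₁} ⋊ H₁` has infinitely many denominators
`1 - γ_j + … + γ_j^{2m}` is not finitely generated: the first components of a finitely generated
subgroup have a common denominator. -/
theorem not_fg_of_denominators {n : ℕ} {Q : Type*} [Group Q] (f : Q →* FoxGroup n) (j : Fin n)
    (hf : ∀ m : ℕ, ∃ v : Q, algebraMap _ (KField n)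
      (altSum (Abelianization.of (FreeGroup.of j)) m) * (f v).left = 1) : ¬ Group.FG Q := by
  classical
  rintro ⟨S, hS⟩
  obtain ⟨q, hq⟩ := IsLocalization.exist_integer_multiples_of_finset
    (nonZeroDivisors (MonoidAlgebra ℤ (FreeH1 n))) (S.image fun v => (f v).left)
  have key : ∀ v : Q, ∃ r, algebraMap (MonoidAlgebra ℤ (FreeH1 n)) (KField n) r =
      algebraMap _ (KField n) (q : MonoidAlgebra ℤ (FreeH1 n)) * (f v).left := by
    intro v
    have hv : v ∈ Subgroup.closure (S : Set Q) := hS ▸ Subgroup.mem_top v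
    induction hv using Subgroup.closure_induction with
    | mem v hv =>
      obtain ⟨r, hr⟩ := hq _ (Finset.mem_image_of_mem _ hv)
      exact ⟨r, hr.trans (Algebra.smul_def _ _)⟩
    | one => exact ⟨0, by simp⟩
    | mul u v _ _ hu hv =>
      obtain ⟨r, hr⟩ := hu
      obtain ⟨s, hs⟩ := hv
      refine ⟨r + MonoidAlgebra.of ℤ _ (f u).right * s, ?_⟩
      rw [map_add, map_mul (algebraMap _ _), hr, hs, map_mul f, AffineGroup.mul_left]
      ring
    | inv v _ hv =>
      obtain ⟨r, hr⟩ := hv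
      refine ⟨-(MonoidAlgebra.of ℤ _ (f v).right⁻¹ * r), ?_⟩
      rw [map_neg, map_mul, hr, map_inv f, AffineGroup.inv_left]
      ring
  let e : FreeH1 n →* Multiplicative ℤ :=
    Abelianization.lift (FreeGroup.lift fun _ => Multiplicative.ofAdd 1)
  have he : e (Abelianization.of (FreeGroup.of j)) = Multiplicative.ofAdd 1 := by simp [e]
  refine nonZeroDivisors.coe_ne_zero q (eq_zero_of_forall_sum_neg_pow_dvd he fun p hp hp2 => ?_)
  obtain ⟨m, rfl⟩ := hp.odd_of_ne_two hp2
  obtain ⟨v, hv⟩ := hf m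
  obtain ⟨r, hr⟩ := key v
  refine ⟨r, IsFractionRing.injective _ (KField n) ?_⟩
  change _ = algebraMap _ _ (altSum _ m * r)
  rw [map_mul, hr, mul_left_comm, hv, mul_one]

theorem irreducible_altSum {n m : ℕ} (j : Fin n) (hm : (2 * m + 1).Prime) :
    Irreducible (altSum (Abelianization.of (FreeGroup.of j)) m) := by
  -- The total degree is as good as the exponent of `γ_j`: only its value `1` at `γ_j` matters.
  let e : FreeH1 n →* Multiplicative ℤ :=
    Abelianization.lift (FreeGroup.lift fun _ => Multiplicative.ofAdd 1)
  have he : e (Abelianization.of (FreeGroup.of j)) = Multiplicative.ofAdd 1 := by simp [e]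
  exact (prime_sum_neg_pow he hm (by omega)).irreducible

theorem altSum_injective {n : ℕ} (j : Fin n) :
    Function.Injective (altSum (n := n) (Abelianization.of (FreeGroup.of j))) := by
  let s : FreeH1 n →* ℤ := (Units.coeHom ℤ).comp (Abelianization.lift (FreeGroup.lift fun _ => -1))
  -- Under `γ_j ↦ -1` the element `1 - γ_j + … + γ_j^{2m}` becomes `2m + 1`.
  have h : ∀ m, MonoidAlgebra.lift ℤ ℤ _ s (altSum (Abelianization.of (FreeGroup.of j)) m) =
      2 * m + 1 := by
    intro m
    simp [altSum, s]
  intro m m' hmm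
  have := (h m).symm.trans ((congrArg _ hmm).trans (h m'))
  omega

/-- For `n ≥ 2` the acyclic closure of the free group `F_n` is not finitely generated; infinitely
many distinct irreducible denominators `1 - γ₂ + … + γ₂^{2m}` occur among the extended Fox
derivatives (which are well defined, as `χ` is bijective); and the metabelian quotient of the
acyclic closure is not finitely generated either. -/
theorem theorem8p6 (n : ℕ) (hn : 2 ≤ n) :
    ¬ Group.FG (FAcy n) ∧
    Function.Bijective (chi n) ∧
    (∀ m : ℕ, (2 * m + 1).Prime →
      Irreducible (altSum (Abelianization.of (FreeGroup.of (⟨1, by omega⟩ : Fin n))) m) ∧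
      ∃ v : FAcy n, foxDeriv ⟨0, by omega⟩ v =
        1 / algebraMap (MonoidAlgebra ℤ (FreeH1 n)) (KField n)
          (altSum (Abelianization.of (FreeGroup.of (⟨1, by omega⟩ : Fin n))) m)) ∧
    {q : MonoidAlgebra ℤ (FreeH1 n) | Irreducible q ∧
      (∃ m : ℕ, q = altSum (Abelianization.of (FreeGroup.of (⟨1, by omega⟩ : Fin n))) m) ∧
      ∃ v : FAcy n, foxDeriv ⟨0, by omega⟩ v =
        1 / algebraMap (MonoidAlgebra ℤ (FreeH1 n)) (KField n) q}.Infinite ∧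
    ¬ Group.FG (FAcy n ⧸ ⁅commutator (FAcy n), commutator (FAcy n)⁆) := by
  let i : Fin n := ⟨0, by omega⟩
  let j : Fin n := ⟨1, by omega⟩
  have hij : j ≠ i := by simp [i, j]
  have hden : ∀ m : ℕ, ∃ v : FAcy n, foxDeriv i v =
      1 / algebraMap (MonoidAlgebra ℤ (FreeH1 n)) (KField n)
        (altSum (Abelianization.of (FreeGroup.of j)) m) := by
    intro m
    obtain ⟨v, hv⟩ := exists_altSum_mul_foxHom_left hij m
    exact ⟨v, by rw [foxDeriv_eq, one_div, eq_inv_of_mul_eq_one_right hv]⟩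
  refine ⟨not_fg_of_denominators (foxHom i) j (exists_altSum_mul_foxHom_left hij),
    chi_bijective n, fun m hm => ⟨irreducible_altSum j hm, hden m⟩, ?_, ?_⟩
  · have hinf : {m : ℕ | (2 * m + 1).Prime}.Infinite := by
      refine Set.infinite_of_forall_exists_gt fun N => ?_
      obtain ⟨p, hNp, hp⟩ := Nat.exists_infinite_primes (2 * N + 3)
      obtain ⟨m, rfl⟩ := hp.odd_of_ne_two (by omega)
      exact ⟨m, hp, by omega⟩
    refine (hinf.image (altSum_injective j).injOn).mono ?_
    rintro _ ⟨m, hm, rfl⟩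
    exact ⟨irreducible_altSum j hm, ⟨m, rfl⟩, hden m⟩
  · refine not_fg_of_denominators
      (QuotientGroup.lift _ (foxHom i) (AffineGroup.map_derived_eq_one _)) j fun m => ?_
    obtain ⟨v, hv⟩ := exists_altSum_mul_foxHom_left hij m
    exact ⟨QuotientGroup.mk v, hv⟩
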